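/- Let $\mathbb B_d=\{z\in\mathbb C^d:\sum_{j=1}^d|z_j|^2<1\}$ and let $V\subseteq\mathbb B_d$ be nonempty. Suppose that (a) $V$ is relatively polynomially convex in $\mathbb B_d$, i.e. $\hat V\cap\mathbb B_d=V$, where $\hat V=\{z\in\mathbb C^d: |p(z)|\le\sup_V|p|\text{ for every polynomial }p\in\mathbb C[z_1,\dots,z_d]\}$; (b) $V$ has the extension property: for every polynomial $p\in\mathbb C[z_1,\dots,z_d]$ there is a bounded holomorphic function $F:\mathbb B_d\to\mathbb C$ with $F|_V=p|_V$ and $\sup_{\mathbb B_d}|F|=\sup_V|p|$. Then $V$ is a retract of $\mathbb B_d$, i.e. there is a holomorphic map $r:\mathbb B_d\to\mathbb B_d$ whose range is $V$ and whose restriction to $V$ is the identity. More precisely, there are an integer $k$ with $0\le k\le d$ and a biholomorphic automorphism $\Phi$ of $\mathbb B_d$ such that $$V=\Phi\bigl(\{z\in\mathbb B_d: z_{k+1}=\dots=z_d=0\}\bigr).$$ -/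

import Mathlib

namespace BallExtension

/-- Complex Euclidean space of dimension `d`. -/
abbrev Cn (d : ℕ) : Type := EuclideanSpace ℂ (Fin d)

/-- The open unit ball of `ℂ^d`, for the Euclidean norm. -/
def unitBall (d : ℕ) : Set (Cn d) := Metric.ball 0 1

/-- The polynomial function on `ℂ^d` given by a polynomial in `d` variables. -/
noncomputable def polyFun {d : ℕ} (p : MvPolynomial (Fin d) ℂ) (z : Cn d) : ℂ :=
  MvPolynomial.eval (fun i => z i) p

/-- The supremum of `|f|` over `S`, as an extended nonnegative real (so `∞` if `f` is unbounded
on `S`, and `0` if `S` is empty). -/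
noncomputable def supNorm {d : ℕ} (S : Set (Cn d)) (f : Cn d → ℂ) : ENNReal :=
  ⨆ z ∈ S, ‖f z‖ₑ

/-- The polynomial hull of a set `V`: the points `z` with `|p(z)| ≤ sup_V |p|` for every
polynomial `p`. -/
def polyHull {d : ℕ} (V : Set (Cn d)) : Set (Cn d) :=
  {z | ∀ p : MvPolynomial (Fin d) ℂ, ‖polyFun p z‖ₑ ≤ supNorm V (polyFun p)}

/-- `V` is relatively polynomially convex in `Ω`: the polynomial hull of `V` meets `Ω` exactly in
`V`. In particular `V ⊆ Ω`. -/
def RelPolyConvex {d : ℕ} (Ω V : Set (Cn d)) : Prop := polyHull V ∩ Ω = V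

/-- `F` belongs to `H^∞(Ω)`: it is holomorphic and bounded on the open set `Ω`. -/
def IsHInfty {d : ℕ} (Ω : Set (Cn d)) (F : Cn d → ℂ) : Prop :=
  DifferentiableOn ℂ F Ω ∧ supNorm Ω F < ⊤

/-- The extension property of a subset `V` of a bounded open set `Ω`: the restriction to `V` of
every polynomial extends to a function in `H^∞(Ω)` with the same supremum norm. -/
def HasExtensionProperty {d : ℕ} (Ω V : Set (Cn d)) : Prop :=
  ∀ p : MvPolynomial (Fin d) ℂ, ∃ F : Cn d → ℂ, IsHInfty Ω F ∧
    (∀ z ∈ V, F z = polyFun p z) ∧ supNorm Ω F = supNorm V (polyFun p)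

/-- `V` is a (holomorphic) retract of the open set `Ω`. -/
def IsRetract {d : ℕ} (Ω V : Set (Cn d)) : Prop :=
  ∃ r : Cn d → Cn d, DifferentiableOn ℂ r Ω ∧ Set.MapsTo r Ω Ω ∧ r '' Ω = V ∧
    ∀ z ∈ V, r z = z

/-- `Φ` restricts to a (biholomorphic) automorphism of the open set `Ω`: it is holomorphic on `Ω`,
maps `Ω` to itself, and has a two-sided inverse with the same properties. -/
def IsAutomorphism {d : ℕ} (Ω : Set (Cn d)) (Φ : Cn d → Cn d) : Prop :=
  DifferentiableOn ℂ Φ Ω ∧ Set.MapsTo Φ Ω Ω ∧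
    ∃ Ψ : Cn d → Cn d, DifferentiableOn ℂ Ψ Ω ∧ Set.MapsTo Ψ Ω Ω ∧ Set.InvOn Ψ Φ Ω Ω

/-- The `k`-dimensional ball inside the unit ball of `ℂ^d`, embedded as `z ↦ (z, 0)`: the points
of the unit ball all of whose coordinates beyond the first `k` vanish. -/
def subBall (d k : ℕ) : Set (Cn d) :=
  {z | z ∈ unitBall d ∧ ∀ i : Fin d, k ≤ (i : ℕ) → z i = 0}

/-- The other usual definition of relative polynomial convexity (`V` is relatively closed in `Ω`
and its closure is polynomially convex) implies the one used here. -/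
theorem RelPolyConvex.of_closure {d : ℕ} {Ω V : Set (Cn d)} (hV : closure V ∩ Ω = V)
    (hc : polyHull (closure V) = closure V) : RelPolyConvex Ω V := by
  apply Set.Subset.antisymm
  · rintro z ⟨hz, hzΩ⟩
    rw [← hV, ← hc]
    exact ⟨fun p => (hz p).trans (biSup_mono fun _ h => subset_closure h), hzΩ⟩
  · intro z hz
    exact ⟨fun p => le_iSup₂ (f := fun w (_ : w ∈ V) => ‖polyFun p w‖ₑ) z hz,
      (hV.symm ▸ hz : z ∈ closure V ∩ Ω).2⟩

end BallExtension

/-! Let φ_a be the involution `moebius a`, take a, b ∈ V with φ_a(b) ≠ 0, and let u be the unit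
vector along φ_a(b). Every boundary point φ_a(ωu), |ω| = 1, lies in the closure of V
(`moebius_smul_mem_closure`). Otherwise f = ⟨u, φ_a⟩ avoids a neighbourhood of ω on V, and
multiplying f by the exponential of a Poisson kernel peaking near ω keeps it bounded by 1 on V but
makes its value at b exceed ‖φ_a(b)‖. A norm-preserving extension would then violate the Schwarz
lemma (`norm_le_norm_moebius_of_isPolynomialLimit`).

The maximum principle on the disc and polynomial convexity put the whole geodesic through a and b in
V. These geodesics are the sections of the ball by complex lines, and φ_a maps lines to lines, so
φ_a(V) contains 0 and is closed under affine combinations inside the ball. It is therefore a linear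
section, hence a unitary image of a coordinate ball. -/

open scoped InnerProductSpace ComplexConjugate

namespace BallExtension

/-! ### Ball involutions -/

section Moebius

variable {E : Type*} [NormedAddCommGroup E] [InnerProductSpace ℂ E]

/-- The involutive automorphism of the unit ball of a complex inner product space that
exchanges `0` and `a`. -/
noncomputable def moebius (a z : E) : E :=
  (1 - ⟪a, z⟫_ℂ)⁻¹ • (a - (√(1 - ‖a‖ ^ 2) : ℂ) • z -
    (⟪a, z⟫_ℂ / (1 + (√(1 - ‖a‖ ^ 2) : ℂ))) • a)

theorem one_sub_inner_ne_zero {a z : E} (ha : ‖a‖ < 1) (hz : ‖z‖ ≤ 1) :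
    (1 : ℂ) - ⟪a, z⟫_ℂ ≠ 0 := by
  intro h
  have h1 : ⟪a, z⟫_ℂ = 1 := (sub_eq_zero.mp h).symm
  have h2 := norm_inner_le_norm (𝕜 := ℂ) a z
  rw [h1, norm_one] at h2
  nlinarith [norm_nonneg a, norm_nonneg z]

/-- The relation ‖a‖² = 1 - s² turns (1 - s)/‖a‖² into 1/(1 + s). This is why `moebius` needs no
division by ‖a‖² and a = 0 is not exceptional. -/
theorem exists_sqrt_one_sub {a : E} (ha : ‖a‖ < 1) : ∃ s : ℝ, 0 < s ∧ √(1 - ‖a‖ ^ 2) = s ∧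
    ⟪a, a⟫_ℂ = 1 - (s : ℂ) ^ 2 ∧ (1 : ℂ) + s ≠ 0 ∧ (s : ℂ) ≠ 0 ∧ s ^ 2 = 1 - ‖a‖ ^ 2 := by
  have h : 0 < 1 - ‖a‖ ^ 2 := by nlinarith [norm_nonneg a]
  have hs := Real.sqrt_pos.mpr h
  have hsq := Real.sq_sqrt h.le
  refine ⟨_, hs, rfl, ?_, ?_, ?_, hsq⟩
  · rw [← Complex.ofReal_pow, hsq, inner_self_eq_norm_sq_to_K]
    push_cast
    simp
  · exact_mod_cast (by positivity : (1 : ℝ) + √(1 - ‖a‖ ^ 2) ≠ 0)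
  · exact_mod_cast hs.ne'

theorem moebius_zero (a : E) : moebius a 0 = a := by simp [moebius]

theorem moebius_self {a : E} (ha : ‖a‖ < 1) : moebius a a = 0 := by
  obtain ⟨s, -, hs, haa, h1, -, -⟩ := exists_sqrt_one_sub ha
  rw [moebius, hs, haa]
  have : ((1 - (s : ℂ) ^ 2) / (1 + s)) = 1 - s := by field_simp; ring
  rw [this]
  module

theorem one_sub_norm_moebius_sq {a z : E} (ha : ‖a‖ < 1) (hz : ‖z‖ ≤ 1) :
    (1 - ‖moebius a z‖ ^ 2) * ‖1 - ⟪a, z⟫_ℂ‖ ^ 2 = (1 - ‖a‖ ^ 2) * (1 - ‖z‖ ^ 2) := by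
  obtain ⟨s, -, hs, haa, h1, -, hs2⟩ := exists_sqrt_one_sub ha
  have hx := one_sub_inner_ne_zero ha hz
  have hx' : ‖1 - ⟪a, z⟫_ℂ‖ ≠ 0 := norm_ne_zero_iff.mpr hx
  rw [← hs2, moebius, hs, norm_smul, norm_inv, mul_pow, inv_pow, sub_mul,
    mul_right_comm, inv_mul_cancel₀ (pow_ne_zero 2 hx')]
  set N := a - (s : ℂ) • z - (⟪a, z⟫_ℂ / (1 + (s : ℂ))) • a with hN
  have key : ((‖N‖ ^ 2 : ℝ) : ℂ) = ((‖1 - ⟪a, z⟫_ℂ‖ ^ 2 - s ^ 2 * (1 - ‖z‖ ^ 2) : ℝ) : ℂ) := by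
    have e1 : ((‖N‖ ^ 2 : ℝ) : ℂ) = ⟪N, N⟫_ℂ := by
      rw [inner_self_eq_norm_sq_to_K]; push_cast; simp
    have e2 : ((‖z‖ ^ 2 : ℝ) : ℂ) = ⟪z, z⟫_ℂ := by
      rw [inner_self_eq_norm_sq_to_K]; push_cast; simp
    have e3 : ((‖1 - ⟪a, z⟫_ℂ‖ ^ 2 : ℝ) : ℂ) = (1 - ⟪z, a⟫_ℂ) * (1 - ⟪a, z⟫_ℂ) := by
      rw [Complex.ofReal_pow, ← Complex.conj_mul', map_sub, map_one, inner_conj_symm]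
    have e4 : (1 : ℂ) + conj (s : ℂ) = 1 + s := by simp
    rw [Complex.ofReal_sub, Complex.ofReal_mul, Complex.ofReal_sub, e1, e2, e3, hN]
    simp only [inner_sub_left, inner_sub_right, inner_smul_left, inner_smul_right, haa,
      map_div₀, map_add, map_one, inner_conj_symm, Complex.conj_ofReal, Complex.ofReal_pow,
      Complex.ofReal_one]
    field_simp
    ring
  have key' := Complex.ofReal_injective key
  rw [key']
  ring

theorem norm_moebius_lt_one {a z : E} (ha : ‖a‖ < 1) (hz : ‖z‖ < 1) : ‖moebius a z‖ < 1 := by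
  have h := one_sub_norm_moebius_sq ha hz.le
  have h1 : 0 < ‖1 - ⟪a, z⟫_ℂ‖ ^ 2 := by
    have := norm_pos_iff.mpr (one_sub_inner_ne_zero ha hz.le)
    positivity
  have h2 : 0 < (1 - ‖a‖ ^ 2) * (1 - ‖z‖ ^ 2) := by
    apply mul_pos <;> nlinarith [norm_nonneg a, norm_nonneg z]
  rw [← h] at h2
  have h3 := pos_of_mul_pos_left h2 h1.le
  nlinarith [norm_nonneg (moebius a z)]

theorem norm_moebius_le_one {a z : E} (ha : ‖a‖ < 1) (hz : ‖z‖ ≤ 1) : ‖moebius a z‖ ≤ 1 := by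
  have h := one_sub_norm_moebius_sq ha hz
  have h1 : 0 < ‖1 - ⟪a, z⟫_ℂ‖ ^ 2 := by
    have := norm_pos_iff.mpr (one_sub_inner_ne_zero ha hz)
    positivity
  have h2 : 0 ≤ (1 - ‖a‖ ^ 2) * (1 - ‖z‖ ^ 2) := by
    apply mul_nonneg <;> nlinarith [norm_nonneg a, norm_nonneg z]
  rw [← h] at h2
  have h3 := nonneg_of_mul_nonneg_left h2 h1
  nlinarith [norm_nonneg (moebius a z)]

theorem moebius_moebius {a z : E} (ha : ‖a‖ < 1) (hz : ‖z‖ ≤ 1) :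
    moebius a (moebius a z) = z := by
  obtain ⟨s, -, hs, haa, h1, h0, hs2⟩ := exists_sqrt_one_sub ha
  have hx := one_sub_inner_ne_zero ha hz
  have hin : ⟪a, moebius a z⟫_ℂ = (1 - (s : ℂ) ^ 2 - ⟪a, z⟫_ℂ) / (1 - ⟪a, z⟫_ℂ) := by
    rw [moebius, hs]
    simp only [inner_sub_right, inner_smul_right, haa]
    field_simp
    ring
  have h2 : (1 - ⟪a, moebius a z⟫_ℂ)⁻¹ = (1 - ⟪a, z⟫_ℂ) / (s : ℂ) ^ 2 := by
    rw [hin]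
    have : 1 - (1 - (s : ℂ) ^ 2 - ⟪a, z⟫_ℂ) / (1 - ⟪a, z⟫_ℂ) = s ^ 2 / (1 - ⟪a, z⟫_ℂ) := by
      field_simp; ring
    rw [this, inv_div]
  rw [moebius, h2, hin, hs, moebius, hs]
  generalize ⟪a, z⟫_ℂ = x at *
  match_scalars <;> field_simp
  ring

/-- Numerator and denominator of φ_a are affine in z, so lines go to lines; m is c reweighted by the
denominators. -/
theorem moebius_affine {a p q : E} {c : ℂ} (ha : ‖a‖ < 1) (hp : ‖p‖ < 1) (hq : ‖q‖ < 1)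
    (hc : ‖(1 - c) • p + c • q‖ < 1) :
    ∃ m : ℂ, moebius a ((1 - c) • p + c • q) = (1 - m) • moebius a p + m • moebius a q := by
  have h1 := one_sub_inner_ne_zero ha hp.le
  have h2 := one_sub_inner_ne_zero ha hq.le
  have h3 := one_sub_inner_ne_zero ha hc.le
  obtain ⟨s, -, hs, -, hs1, -, -⟩ := exists_sqrt_one_sub ha
  rw [inner_add_right, inner_smul_right, inner_smul_right] at h3
  refine ⟨c * (1 - ⟪a, q⟫_ℂ) / (1 - ((1 - c) * ⟪a, p⟫_ℂ + c * ⟪a, q⟫_ℂ)), ?_⟩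
  simp only [moebius, inner_add_right, inner_smul_right, hs]
  generalize ⟪a, p⟫_ℂ = x at *
  generalize ⟪a, q⟫_ℂ = y at *
  match_scalars <;> field_simp <;> ring

theorem differentiableAt_moebius {a z : E} (ha : ‖a‖ < 1) (hz : ‖z‖ ≤ 1) :
    DifferentiableAt ℂ (moebius a) z := by
  have hin : DifferentiableAt ℂ (fun z => ⟪a, z⟫_ℂ) z := (innerSL ℂ a).differentiableAt
  have h := one_sub_inner_ne_zero ha hz
  unfold moebius
  fun_prop (disch := assumption)

end Moebius


/-! ### Uniform limits of polynomials on the closed ball -/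

section PolynomialLimit

variable {d : ℕ}

/-- The algebra of continuous functions on the closed unit ball that are uniform limits of
polynomials. -/
noncomputable def ballAlgebra (d : ℕ) :
    Subalgebra ℂ C(Metric.closedBall (0 : Cn d) 1, ℂ) :=
  (MvPolynomial.aeval (R := ℂ) fun i : Fin d =>
    (⟨fun z => z.1 i, by fun_prop⟩ : C(Metric.closedBall (0 : Cn d) 1, ℂ))).range.topologicalClosure

/-- `h` agrees on the closed unit ball with a uniform limit of polynomials. -/
def IsPolynomialLimit (h : Cn d → ℂ) : Prop :=
  ∃ g ∈ ballAlgebra d, ∀ z : Metric.closedBall (0 : Cn d) 1, g z = h z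

theorem aeval_coord_apply (p : MvPolynomial (Fin d) ℂ) (z : Metric.closedBall (0 : Cn d) 1) :
    (MvPolynomial.aeval (R := ℂ) (fun i : Fin d =>
      (⟨fun z => z.1 i, by fun_prop⟩ : C(Metric.closedBall (0 : Cn d) 1, ℂ))) p) z
      = polyFun p z.1 := by
  rw [polyFun]
  induction p using MvPolynomial.induction_on with
  | C c => simp
  | add p q hp hq => simp [hp, hq]
  | mul_X p i hp => simp [hp]

theorem isClosed_ballAlgebra : IsClosed (ballAlgebra d : Set C(Metric.closedBall (0 : Cn d) 1, ℂ)) :=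
  Subalgebra.isClosed_topologicalClosure _

theorem isPolynomialLimit_polyFun (p : MvPolynomial (Fin d) ℂ) :
    IsPolynomialLimit (polyFun p) :=
  ⟨_, Subalgebra.le_topologicalClosure _ ⟨p, rfl⟩, aeval_coord_apply p⟩

namespace IsPolynomialLimit

variable {f g : Cn d → ℂ}

theorem exists_polynomial (hf : IsPolynomialLimit f) {ε : ℝ} (hε : 0 < ε) :
    ∃ p : MvPolynomial (Fin d) ℂ, ∀ z : Cn d, ‖z‖ ≤ 1 → ‖f z - polyFun p z‖ < ε := by
  obtain ⟨g, hg, hgf⟩ := hf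
  obtain ⟨_, ⟨p, rfl⟩, hp⟩ := Metric.mem_closure_iff.mp hg ε hε
  refine ⟨p, fun z hz => ?_⟩
  have h := (ContinuousMap.dist_apply_le_dist
    (⟨z, mem_closedBall_zero_iff.mpr hz⟩ : Metric.closedBall (0 : Cn d) 1)).trans_lt hp
  rw [hgf, dist_eq_norm] at h
  rwa [← aeval_coord_apply p ⟨z, mem_closedBall_zero_iff.mpr hz⟩]

theorem congr (hf : IsPolynomialLimit f) (h : ∀ z, ‖z‖ ≤ 1 → f z = g z) :
    IsPolynomialLimit g := by
  obtain ⟨k, hk, hkf⟩ := hf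
  exact ⟨k, hk, fun z => (hkf z).trans (h z (mem_closedBall_zero_iff.mp z.2))⟩

theorem const (c : ℂ) : IsPolynomialLimit (fun _ : Cn d => c) :=
  ⟨algebraMap ℂ _ c, Subalgebra.algebraMap_mem _ c, fun _ => rfl⟩

theorem add (hf : IsPolynomialLimit f) (hg : IsPolynomialLimit g) :
    IsPolynomialLimit (fun z => f z + g z) := by
  obtain ⟨f', hf', hff⟩ := hf
  obtain ⟨g', hg', hgg⟩ := hg
  exact ⟨f' + g', add_mem hf' hg', fun z => by simp [hff, hgg]⟩

theorem mul (hf : IsPolynomialLimit f) (hg : IsPolynomialLimit g) :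
    IsPolynomialLimit (fun z => f z * g z) := by
  obtain ⟨f', hf', hff⟩ := hf
  obtain ⟨g', hg', hgg⟩ := hg
  exact ⟨f' * g', mul_mem hf' hg', fun z => by simp [hff, hgg]⟩

theorem sub (hf : IsPolynomialLimit f) (hg : IsPolynomialLimit g) :
    IsPolynomialLimit (fun z => f z - g z) := by
  simpa [sub_eq_add_neg] using hf.add ((const (-1)).mul hg)

theorem inner (a : Cn d) : IsPolynomialLimit (fun z => ⟪a, z⟫_ℂ) := by
  refine (isPolynomialLimit_polyFun
    (∑ i, MvPolynomial.C (conj (a i)) * MvPolynomial.X i)).congr fun z _ => ?_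
  simp [polyFun, PiLp.inner_apply, mul_comm]

/-- The geometric series converges in the closed algebra; the uniform bound r < 1 makes the norm
less than 1. -/
theorem inv_one_sub (hf : IsPolynomialLimit f) {r : ℝ} (hr : r < 1)
    (hfr : ∀ z, ‖z‖ ≤ 1 → ‖f z‖ ≤ r) : IsPolynomialLimit (fun z => (1 - f z)⁻¹) := by
  obtain ⟨g, hg, hgf⟩ := hf
  have hg1 : ‖g‖ < 1 := (ContinuousMap.norm_lt_iff _ one_pos).mpr fun z =>
    (hgf z ▸ hfr z (mem_closedBall_zero_iff.mp z.2)).trans_lt hr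
  refine ⟨∑' n : ℕ, g ^ n, tsum_mem isClosed_ballAlgebra fun n => pow_mem hg n, fun z => ?_⟩
  have h := DFunLike.congr_fun (mul_neg_geom_series g hg1) z
  rw [ContinuousMap.mul_apply, ContinuousMap.sub_apply, ContinuousMap.one_apply, hgf] at h
  exact eq_inv_of_mul_eq_one_right h

theorem cexp (hf : IsPolynomialLimit f) : IsPolynomialLimit (fun z => Complex.exp (f z)) := by
  obtain ⟨g, hg, hgf⟩ := hf
  refine ⟨NormedSpace.exp g, NormedSpace.exp_mem (R := ℂ) isClosed_ballAlgebra hg, fun z => ?_⟩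
  have h := NormedSpace.map_exp (ContinuousMap.evalAlgHom ℂ ℂ z)
    (continuous_eval_const z) g
  rw [Complex.exp_eq_exp_ℂ]
  simpa only [← hgf] using! h

end IsPolynomialLimit

theorem isPolynomialLimit_inner_moebius {a : Cn d} (ha : ‖a‖ < 1) (u : Cn d) :
    IsPolynomialLimit (fun z => ⟪u, moebius a z⟫_ℂ) := by
  have h1 : IsPolynomialLimit (fun z => (1 - ⟪a, z⟫_ℂ)⁻¹) :=
    (IsPolynomialLimit.inner a).inv_one_sub ha fun z hz =>
      (norm_inner_le_norm a z).trans (mul_le_of_le_one_right (norm_nonneg a) hz)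
  refine (h1.mul (((IsPolynomialLimit.const ⟪u, a⟫_ℂ).sub
    ((IsPolynomialLimit.const (√(1 - ‖a‖ ^ 2) : ℂ)).mul (IsPolynomialLimit.inner u))).sub
    ((IsPolynomialLimit.inner a).mul (IsPolynomialLimit.const
      ((1 + (√(1 - ‖a‖ ^ 2) : ℂ))⁻¹ * ⟪u, a⟫_ℂ))))).congr fun z _ => ?_
  simp only [moebius, inner_smul_right, inner_sub_right]
  ring

theorem differentiable_polyFun (p : MvPolynomial (Fin d) ℂ) : Differentiable ℂ (polyFun p) := by
  induction p using MvPolynomial.induction_on with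
  | C c =>
    have h : polyFun (d := d) (.C c) = fun _ => c := by ext; simp [polyFun]
    exact h ▸ differentiable_const c
  | add p q hp hq =>
    have h : polyFun (p + q) = polyFun p + polyFun q := by ext; simp [polyFun]
    exact h ▸ hp.add hq
  | mul_X p i hp =>
    have h : polyFun (p * .X i) = polyFun p * fun z => z i := by ext; simp [polyFun]
    exact h ▸ hp.mul (by fun_prop)

end PolynomialLimit


/-! ### A Poisson kernel estimate -/

section Poisson

/-- The left side is the real part of (1 + w)/(1 - w), written so that
`IsPolynomialLimit.inv_one_sub` applies to it. -/
theorem re_two_mul_inv_one_sub {w : ℂ} (hw : ‖w‖ < 1) :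
    (2 * (1 - w)⁻¹ - 1).re = (1 - ‖w‖ ^ 2) / ‖1 - w‖ ^ 2 := by
  have h1 : (1 : ℂ) - w ≠ 0 := by
    intro h
    rw [← sub_eq_zero.mp h, norm_one] at hw
    exact lt_irrefl _ hw
  have h2 : Complex.normSq (1 - w) ≠ 0 := (Complex.normSq_pos.mpr h1).ne'
  rw [← Complex.normSq_eq_norm_sq, ← Complex.normSq_eq_norm_sq, eq_div_iff h2]
  have h3 : (2 * (1 - w)⁻¹ - 1).re = 2 * ((1 - w).re / Complex.normSq (1 - w)) - 1 := by
    simp [Complex.inv_re]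
  rw [h3, sub_mul, mul_assoc, div_mul_cancel₀ _ h2]
  simp only [Complex.normSq_apply, Complex.sub_re, Complex.sub_im, Complex.one_re, Complex.one_im]
  ring

/-- Away from a boundary point `ω`, the Schwarz lemma bound can be relaxed: multiplying by the
exponential of a Poisson kernel keeps functions bounded by `1` and increases values at `t`. -/
theorem exists_poisson_multiplier {t ρ : ℝ} (ht0 : 0 < t) (ht1 : t < 1) (hρ : 0 < ρ) {ω : ℂ}
    (hω : ‖ω‖ = 1) : ∃ k : ℂ, ∃ c ε : ℝ, ‖k‖ < 1 ∧ 0 < ε ∧ c < (2 * (1 - k * t)⁻¹ - 1).re ∧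
      ∀ ζ : ℂ, ‖ζ‖ ≤ 1 → ρ ≤ ‖ζ - ω‖ →
        ‖ζ‖ * Real.exp (ε * ((2 * (1 - k * ζ)⁻¹ - 1).re - c)) ≤ 1 := by
  -- c lies below (1 - t)/(1 + t), Harnack's lower bound for the kernel at t.
  obtain ⟨c, hc0, hc⟩ : ∃ c : ℝ, 0 < c ∧ c * (1 + t) < 1 - t :=
    ⟨(1 - t) / (2 * (1 + t)), by have : 0 < 1 - t := by linarith
                                 positivity, by
      have : 0 < 1 + t := by linarith
      field_simp; linarith⟩
  obtain ⟨δ, hδ0, hδ1, hδρ, hδc⟩ : ∃ δ : ℝ, 0 < δ ∧ δ < 1 ∧ δ ≤ ρ / 2 ∧ 8 * δ ≤ c * ρ ^ 2 := by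
    refine ⟨min (1 / 2) (min (ρ / 2) (c * ρ ^ 2 / 8)), by positivity, ?_, ?_, ?_⟩
    · exact (min_le_left _ _).trans_lt (by norm_num)
    · exact (min_le_right _ _).trans (min_le_left _ _)
    · have := (min_le_right (1 / 2) _).trans (min_le_right (ρ / 2) (c * ρ ^ 2 / 8))
      linarith
  have hk : ‖((1 - δ : ℝ) : ℂ) * conj ω‖ = 1 - δ := by
    rw [norm_mul, RCLike.norm_conj, hω, mul_one, Complex.norm_real, Real.norm_eq_abs,
      abs_of_pos (by linarith)]
  -- This k puts the pole at ω/(1 - δ), just outside the disc. Away from ω the kernel is at most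
  -- (8/ρ²)(1 - |ζ|) + c, so ε = ρ²/8 leaves the exponent at most 1 - |ζ|, and |ζ| ≤ exp(|ζ| - 1).
  refine ⟨((1 - δ : ℝ) : ℂ) * conj ω, c, ρ ^ 2 / 8, by linarith, by positivity, ?_, ?_⟩
  · have hn : ‖((1 - δ : ℝ) : ℂ) * conj ω * t‖ = (1 - δ) * t := by
      rw [norm_mul, hk, Complex.norm_real, Real.norm_eq_abs, abs_of_pos ht0]
    have hr : (1 - δ) * t < t := by nlinarith
    have hr0 : 0 < (1 - δ) * t := mul_pos (by linarith) ht0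
    rw [re_two_mul_inv_one_sub (by linarith), hn]
    have h1 : ‖1 - ((1 - δ : ℝ) : ℂ) * conj ω * t‖ ≤ 1 + (1 - δ) * t := by
      have := norm_sub_le (1 : ℂ) (((1 - δ : ℝ) : ℂ) * conj ω * t)
      rwa [hn, norm_one] at this
    have h0 : 1 - (1 - δ) * t ≤ ‖1 - ((1 - δ : ℝ) : ℂ) * conj ω * t‖ := by
      have := norm_sub_norm_le (1 : ℂ) (((1 - δ : ℝ) : ℂ) * conj ω * t)
      rwa [hn, norm_one] at this
    generalize (1 - δ) * t = r at *
    generalize ‖1 - ((1 - δ : ℝ) : ℂ) * conj ω * t‖ = n at *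
    have hn0 : 0 < n := by linarith
    rw [lt_div_iff₀ (by positivity)]
    calc c * n ^ 2 ≤ c * (1 + r) ^ 2 := by gcongr
      _ < (1 - r) * (1 + r) := by
        rw [pow_two, ← mul_assoc]
        apply mul_lt_mul_of_pos_right _ (by linarith)
        nlinarith
      _ = 1 - r ^ 2 := by ring
  · intro ζ hζ hζω
    have hn : ‖((1 - δ : ℝ) : ℂ) * conj ω * ζ‖ = (1 - δ) * ‖ζ‖ := by rw [norm_mul, hk]
    have hz0 := norm_nonneg ζ
    have hr : (1 - δ) * ‖ζ‖ < 1 := by nlinarith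
    have hr0 : 0 ≤ (1 - δ) * ‖ζ‖ := mul_nonneg (by linarith) hz0
    rw [re_two_mul_inv_one_sub (by linarith), hn]
    have h1 : ρ / 2 ≤ ‖1 - ((1 - δ : ℝ) : ℂ) * conj ω * ζ‖ := by
      have e : ω * (1 - ((1 - δ : ℝ) : ℂ) * conj ω * ζ) = δ * ζ - (ζ - ω) := by
        have : ω * conj ω = 1 := by rw [Complex.mul_conj']; simp [hω]
        push_cast
        linear_combination (-(1 - (δ : ℂ)) * ζ) * this
      have e2 : ‖1 - ((1 - δ : ℝ) : ℂ) * conj ω * ζ‖ = ‖δ * ζ - (ζ - ω)‖ := by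
        rw [← e, norm_mul, hω, one_mul]
      have e3 := norm_sub_norm_le (ζ - ω) (δ * ζ)
      have e4 : ‖(δ : ℂ) * ζ‖ = δ * ‖ζ‖ := by
        rw [norm_mul, Complex.norm_real, Real.norm_eq_abs, abs_of_pos hδ0]
      rw [e2, norm_sub_rev]
      nlinarith
    generalize ‖1 - ((1 - δ : ℝ) : ℂ) * conj ω * ζ‖ = n at *
    generalize ‖ζ‖ = x at *
    have h2 : (1 - ((1 - δ) * x) ^ 2) / n ^ 2 ≤ 8 / ρ ^ 2 * (1 - x) + c := by
      have hn0 : 0 < n := by linarith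
      rw [div_le_iff₀ (by positivity)]
      have h3 : (ρ / 2) ^ 2 ≤ n ^ 2 := by gcongr
      have h4 : 0 ≤ 8 / ρ ^ 2 * (1 - x) + c := by
        have : 0 ≤ 1 - x := by linarith
        positivity
      have h5 : (8 / ρ ^ 2 * (1 - x) + c) * (ρ / 2) ^ 2 = 2 * (1 - x) + c * ρ ^ 2 / 4 := by
        field_simp; ring
      have h6 := mul_le_mul_of_nonneg_left h3 h4
      nlinarith
    have h3 : ρ ^ 2 / 8 * ((1 - ((1 - δ) * x) ^ 2) / n ^ 2 - c) ≤ 1 - x := by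
      calc _ ≤ ρ ^ 2 / 8 * (8 / ρ ^ 2 * (1 - x)) := by gcongr; linarith
        _ = 1 - x := by field_simp
    have h4 : x ≤ Real.exp (x - 1) := by linarith [Real.add_one_le_exp (x - 1)]
    calc _ ≤ Real.exp (x - 1) * Real.exp (1 - x) := by gcongr
      _ = 1 := by rw [← Real.exp_add]; simp

end Poisson

/-! ### Geodesics contained in V -/

section Extension

variable {d : ℕ} {V : Set (Cn d)} {a b : Cn d}

/-- Schwarz lemma for F ∘ φ_a at the point φ_a(b), where F extends a polynomial close to h. -/
theorem norm_le_norm_moebius_of_isPolynomialLimit (hV : V ⊆ unitBall d)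
    (hext : HasExtensionProperty (unitBall d) V) (ha : a ∈ V) (hb : b ∈ V) {h : Cn d → ℂ}
    (hh : IsPolynomialLimit h) (ha0 : h a = 0) (hV1 : ∀ v ∈ V, ‖h v‖ ≤ 1) :
    ‖h b‖ ≤ ‖moebius a b‖ := by
  have hball : ∀ v ∈ V, ‖v‖ < 1 := fun v hv => mem_ball_zero_iff.mp (hV hv)
  refine le_of_forall_pos_le_add fun ε hε => ?_
  obtain ⟨p, hp⟩ := hh.exists_polynomial (show 0 < ε / 4 by positivity)
  obtain ⟨F, ⟨hFd, -⟩, hFV, hFs⟩ := hext p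
  have hpV : supNorm V (polyFun p) ≤ ENNReal.ofReal (1 + ε / 4) := by
    refine iSup₂_le fun v hv => ?_
    rw [← ofReal_norm]
    apply ENNReal.ofReal_le_ofReal
    have h1 := norm_sub_norm_le (polyFun p v) (h v)
    rw [norm_sub_rev] at h1
    linarith [hp v (hball v hv).le, hV1 v hv]
  have hF1 : ∀ z : Cn d, ‖z‖ < 1 → ‖F z‖ ≤ 1 + ε / 4 := fun z hz => by
    have h1 : ‖F z‖ₑ ≤ supNorm (unitBall d) F :=
      le_iSup₂ (f := fun w (_ : w ∈ unitBall d) => ‖F w‖ₑ) z (mem_ball_zero_iff.mpr hz)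
    have h2 := (h1.trans hFs.le).trans hpV
    rw [← ofReal_norm] at h2
    exact (ENNReal.ofReal_le_ofReal_iff (by positivity)).mp h2
  have hFa : ‖F a‖ ≤ ε / 4 := by
    have := hp a (hball a ha).le
    rw [ha0, zero_sub, norm_neg] at this
    rw [hFV a ha]
    exact this.le
  have hFb : ‖h b‖ ≤ ‖F b‖ + ε / 4 := by
    rw [hFV b hb]
    linarith [norm_sub_norm_le (h b) (polyFun p b), hp b (hball b hb).le]
  have hd : DifferentiableOn ℂ (fun z => F (moebius a z)) (Metric.ball 0 1) := by
    refine hFd.comp (fun z hz => (differentiableAt_moebius (hball a ha)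
      (mem_ball_zero_iff.mp hz).le).differentiableWithinAt) fun z hz => ?_
    exact mem_ball_zero_iff.mpr (norm_moebius_lt_one (hball a ha) (mem_ball_zero_iff.mp hz))
  -- F(a) is only within ε/4 of 0, so the radius is (1 + ε/4) + ε/4.
  have hS := Complex.dist_le_div_mul_dist_of_mapsTo_ball (R₂ := 1 + ε / 2) hd
    (fun z hz => by
      have h1 := hF1 _ (norm_moebius_lt_one (hball a ha) (mem_ball_zero_iff.mp hz))
      rw [mem_closedBall_iff_norm, moebius_zero]
      linarith [norm_sub_le (F (moebius a z)) (F a)])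
    (mem_ball_zero_iff.mpr (norm_moebius_lt_one (hball a ha) (hball b hb)))
  rw [moebius_zero, moebius_moebius (hball a ha) (hball b hb).le, dist_zero_right, div_one,
    dist_eq_norm] at hS
  have := norm_moebius_lt_one (hball a ha) (hball b hb)
  have h3 := norm_sub_norm_le (F b) (F a)
  nlinarith

theorem moebius_smul_mem_closure (hV : V ⊆ unitBall d)
    (hext : HasExtensionProperty (unitBall d) V) (ha : a ∈ V) (hb : b ∈ V)
    (hab : moebius a b ≠ 0) {ω : ℂ} (hω : ‖ω‖ = 1) :
    moebius a (ω • ((‖moebius a b‖⁻¹ : ℝ) : ℂ) • moebius a b) ∈ closure V := by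
  have hball : ∀ v ∈ V, ‖v‖ < 1 := fun v hv => mem_ball_zero_iff.mp (hV hv)
  have ha1 := hball a ha
  have ht0 := norm_pos_iff.mpr hab
  have ht1 := norm_moebius_lt_one ha1 (hball b hb)
  set u : Cn d := ((‖moebius a b‖⁻¹ : ℝ) : ℂ) • moebius a b with hu
  have hu1 : ‖u‖ = 1 := by
    rw [hu, norm_smul, Complex.norm_real, norm_inv, norm_norm, inv_mul_cancel₀ ht0.ne']
  have hub : ⟪u, moebius a b⟫_ℂ = (‖moebius a b‖ : ℂ) := by
    rw [hu, inner_smul_left, inner_self_eq_norm_sq_to_K, Complex.conj_ofReal]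
    push_cast
    have : (‖moebius a b‖ : ℂ) ≠ 0 := by exact_mod_cast ht0.ne'
    simp only [Complex.coe_algebraMap]
    field_simp
  have hin : ∀ z : Cn d, ‖z‖ ≤ 1 → ‖⟪u, moebius a z⟫_ℂ‖ ≤ 1 := fun z hz => by
    have := norm_inner_le_norm (𝕜 := ℂ) u (moebius a z)
    rw [hu1, one_mul] at this
    exact this.trans (norm_moebius_le_one ha1 hz)
  have approx : ∀ ρ > 0, ∃ v ∈ V, ‖⟪u, moebius a v⟫_ℂ - ω‖ < ρ := by
    by_contra! hcon
    obtain ⟨ρ, hρ, hcon⟩ := hcon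
    obtain ⟨k, c, ε, hk, hε, hct, hbd⟩ := exists_poisson_multiplier ht0 ht1 hρ hω
    have hf := isPolynomialLimit_inner_moebius ha1 u
    have hq := ((IsPolynomialLimit.const k).mul hf).inv_one_sub hk fun z hz => by
      rw [norm_mul]
      exact mul_le_of_le_one_right (norm_nonneg k) (hin z hz)
    have hh := hf.mul (((IsPolynomialLimit.const (ε : ℂ)).mul
      ((((IsPolynomialLimit.const 2).mul hq).sub (IsPolynomialLimit.const 1)).sub
        (IsPolynomialLimit.const (c : ℂ)))).cexp)
    have hre : ∀ w : ℂ, ‖Complex.exp (ε * (w - c))‖ = Real.exp (ε * (w.re - c)) := fun w => by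
      simp [Complex.norm_exp]
    have key := norm_le_norm_moebius_of_isPolynomialLimit hV hext ha hb hh
      (by simp [moebius_self ha1]) (fun v hv => by
        rw [norm_mul, hre]
        exact hbd _ (hin v (hball v hv).le) (hcon v hv))
    rw [norm_mul, hre, hub, Complex.norm_real, norm_norm] at key
    have h1 : 1 < Real.exp (ε * ((2 * (1 - k * (‖moebius a b‖ : ℂ))⁻¹ - 1).re - c)) :=
      Real.one_lt_exp_iff.mpr (mul_pos hε (sub_pos.mpr hct))
    nlinarith
  -- In the unit ball, closeness of ⟨u, x⟩ to ω forces x near ωu: ‖ωu - x‖² ≤ 2(1 - Re(ω̄⟨u, x⟩)).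
  -- Hence the tolerance η²/2.
  have hcl : ω • u ∈ closure (moebius a '' V) := by
    refine Metric.mem_closure_iff.mpr fun η hη => ?_
    obtain ⟨v, hv, hvω⟩ := approx (η ^ 2 / 2) (by positivity)
    refine ⟨_, ⟨v, hv, rfl⟩, ?_⟩
    have h1 := norm_moebius_lt_one ha1 (hball v hv)
    have h2 : ‖ω • u - moebius a v‖ ^ 2 =
        1 - 2 * (conj ω * ⟪u, moebius a v⟫_ℂ).re + ‖moebius a v‖ ^ 2 := by
      rw [@norm_sub_sq ℂ, norm_smul, hω, hu1, inner_smul_left]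
      simp
    have h3 : 1 - (conj ω * ⟪u, moebius a v⟫_ℂ).re < η ^ 2 / 2 := by
      have e : 1 - conj ω * ⟪u, moebius a v⟫_ℂ = - (conj ω * (⟪u, moebius a v⟫_ℂ - ω)) := by
        have : conj ω * ω = 1 := by rw [Complex.conj_mul']; simp [hω]
        linear_combination -this
      have e2 := Complex.re_le_norm (1 - conj ω * ⟪u, moebius a v⟫_ℂ)
      rw [e, norm_neg, norm_mul, RCLike.norm_conj, hω, one_mul, ← e] at e2
      simp only [Complex.sub_re, Complex.one_re] at e2
      linarith
    rw [dist_eq_norm]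
    refine lt_of_pow_lt_pow_left₀ 2 hη.le ?_
    nlinarith [norm_nonneg (moebius a v)]
  have hωu : ‖ω • u‖ ≤ 1 := by rw [norm_smul, hω, hu1, mul_one]
  refine closure_mono ?_ (mem_closure_image
    (differentiableAt_moebius ha1 hωu).continuousAt hcl)
  rintro _ ⟨_, ⟨v, hv, rfl⟩, rfl⟩
  rwa [moebius_moebius ha1 (hball v hv).le]

theorem norm_polyFun_le_supNorm_of_mem_closure {p : MvPolynomial (Fin d) ℂ} {z : Cn d}
    (hz : z ∈ closure V) : ‖polyFun p z‖ₑ ≤ supNorm V (polyFun p) := by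
  have hc : IsClosed {z : Cn d | ‖polyFun p z‖ₑ ≤ supNorm V (polyFun p)} :=
    isClosed_le (differentiable_polyFun p).continuous.enorm continuous_const
  exact closure_minimal
    (fun v hv => le_iSup₂ (f := fun w (_ : w ∈ V) => ‖polyFun p w‖ₑ) v hv) hc hz

/-- With any two of its points, `V` contains the complex geodesic of the ball through them. -/
theorem moebius_smul_moebius_mem (hconv : RelPolyConvex (unitBall d) V)
    (hext : HasExtensionProperty (unitBall d) V) (ha : a ∈ V) (hb : b ∈ V) {c : ℂ}
    (hc : ‖c • moebius a b‖ < 1) : moebius a (c • moebius a b) ∈ V := by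
  have hV : V ⊆ unitBall d := fun v hv => by
    rw [← hconv] at hv
    exact hv.2
  have ha1 : ‖a‖ < 1 := mem_ball_zero_iff.mp (hV ha)
  rcases eq_or_ne (moebius a b) 0 with hab | hab
  · rwa [hab, smul_zero, moebius_zero]
  have ht0 := norm_pos_iff.mpr hab
  rw [← hconv]
  refine ⟨fun p => ?_, mem_ball_zero_iff.mpr (norm_moebius_lt_one ha1 hc)⟩
  -- Used only for the finiteness of sup_V |p|.
  obtain ⟨F, ⟨-, hF⟩, -, hFs⟩ := hext p
  rw [hFs] at hF
  set u : Cn d := ((‖moebius a b‖⁻¹ : ℝ) : ℂ) • moebius a b with hu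
  have hu1 : ‖u‖ = 1 := by
    rw [hu, norm_smul, Complex.norm_real, norm_inv, norm_norm, inv_mul_cancel₀ ht0.ne']
  have hdiff : ∀ ζ : ℂ, ‖ζ‖ ≤ 1 → DifferentiableAt ℂ (fun ζ : ℂ => polyFun p (moebius a (ζ • u))) ζ :=
    fun ζ hζ => by
      have h1 : DifferentiableAt ℂ (moebius a) (ζ • u) :=
        differentiableAt_moebius ha1 (by rw [norm_smul, hu1, mul_one]; exact hζ)
      have h2 := h1.comp ζ (by fun_prop : DifferentiableAt ℂ (fun ζ : ℂ => ζ • u) ζ)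
      exact ((differentiable_polyFun p) _).comp ζ h2
  have hmax := Complex.norm_le_of_forall_mem_frontier_norm_le (U := Metric.ball (0 : ℂ) 1)
    (f := fun ζ : ℂ => polyFun p (moebius a (ζ • u))) Metric.isBounded_ball
    (DifferentiableOn.diffContOnCl fun ζ hζ => by
      rw [closure_ball _ one_ne_zero] at hζ
      exact (hdiff ζ (mem_closedBall_zero_iff.mp hζ)).differentiableWithinAt)
    (C := (supNorm V (polyFun p)).toReal) (fun ζ hζ => by
      rw [frontier_ball _ one_ne_zero, mem_sphere_zero_iff_norm] at hζ
      have h := norm_polyFun_le_supNorm_of_mem_closure (p := p)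
        (moebius_smul_mem_closure hV hext ha hb hab hζ)
      rw [← toReal_enorm]
      exact ENNReal.toReal_mono hF.ne h)
    (z := c * ‖moebius a b‖) (by
      refine subset_closure (mem_ball_zero_iff.mpr ?_)
      rwa [norm_mul, Complex.norm_real, norm_norm, ← norm_smul])
  have e : (c * (‖moebius a b‖ : ℂ)) • u = c • moebius a b := by
    have : (‖moebius a b‖ : ℂ) ≠ 0 := by exact_mod_cast ht0.ne'
    rw [hu, smul_smul]
    push_cast
    rw [mul_assoc, mul_inv_cancel₀ this, mul_one]
  rw [e] at hmax
  rw [← ofReal_norm]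
  exact ENNReal.ofReal_le_of_le_toReal hmax

end Extension


/-! ### Linear sections, unitary normal form and retraction -/

section Geometry

variable {d : ℕ} {V : Set (Cn d)} {a : Cn d}

/-- Relatively polynomially convex sets with the extension property contain the intersection of
the ball with the complex affine line through any two of their points. -/
theorem affine_combination_mem (hconv : RelPolyConvex (unitBall d) V)
    (hext : HasExtensionProperty (unitBall d) V) {p q : Cn d} (hp : p ∈ V) (hq : q ∈ V) {c : ℂ}
    (hc : ‖(1 - c) • p + c • q‖ < 1) : (1 - c) • p + c • q ∈ V := by
  have hball : ∀ v ∈ V, ‖v‖ < 1 := fun v hv => by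
    rw [← hconv] at hv
    exact mem_ball_zero_iff.mp hv.2
  -- Centring at p itself sends p to 0, so the image of the line is spanned by φ_p(q).
  obtain ⟨m, hm⟩ := moebius_affine (hball p hp) (hball p hp) (hball q hq) hc
  rw [moebius_self (hball p hp), smul_zero, zero_add] at hm
  rw [← moebius_moebius (hball p hp) hc.le, hm]
  refine moebius_smul_moebius_mem hconv hext hp hq ?_
  rw [← hm]
  exact norm_moebius_lt_one (hball p hp) hc

theorem affine_combination_mem_image_moebius (hconv : RelPolyConvex (unitBall d) V)
    (hext : HasExtensionProperty (unitBall d) V) (ha : a ∈ V) {p q : Cn d}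
    (hp : p ∈ moebius a '' V) (hq : q ∈ moebius a '' V) {c : ℂ}
    (hc : ‖(1 - c) • p + c • q‖ < 1) : (1 - c) • p + c • q ∈ moebius a '' V := by
  have hball : ∀ v ∈ V, ‖v‖ < 1 := fun v hv => by
    rw [← hconv] at hv
    exact mem_ball_zero_iff.mp hv.2
  have ha1 := hball a ha
  obtain ⟨p, hp, rfl⟩ := hp
  obtain ⟨q, hq, rfl⟩ := hq
  obtain ⟨m, hm⟩ := moebius_affine ha1 (norm_moebius_lt_one ha1 (hball p hp))
    (norm_moebius_lt_one ha1 (hball q hq)) hc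
  rw [moebius_moebius ha1 (hball p hp).le, moebius_moebius ha1 (hball q hq).le] at hm
  refine ⟨_, ?_, moebius_moebius ha1 hc.le⟩
  rw [hm]
  refine affine_combination_mem hconv hext hp hq ?_
  rw [← hm]
  exact norm_moebius_lt_one ha1 hc

/-- A subset of the unit ball that contains `0` and is closed under complex affine combinations
of two points within the ball is a linear section of the ball. -/
theorem eq_span_inter_unitBall {W : Set (Cn d)} (hW : W ⊆ unitBall d) (h0 : 0 ∈ W)
    (hline : ∀ p ∈ W, ∀ q ∈ W, ∀ c : ℂ, ‖(1 - c) • p + c • q‖ < 1 → (1 - c) • p + c • q ∈ W) :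
    W = {z | z ∈ unitBall d ∧ z ∈ Submodule.span ℂ W} := by
  have hsmul : ∀ p ∈ W, ∀ c : ℂ, ‖c • p‖ < 1 → c • p ∈ W := fun p hp c hc => by
    simpa using hline 0 h0 p hp c (by simpa using hc)
  refine Set.Subset.antisymm (fun z hz => ⟨hW hz, Submodule.subset_span hz⟩) ?_
  rintro z ⟨hz, hzs⟩
  -- Vectors met in the span induction may leave the ball, so the claim concerns all their multiples
  -- inside it.
  suffices ∀ c : ℂ, ‖c • z‖ < 1 → c • z ∈ W by
    simpa using this 1 (by simpa using mem_ball_zero_iff.mp hz)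
  clear hz
  induction hzs using Submodule.span_induction with
  | mem x hx => exact hsmul x hx
  | zero => simpa using h0
  | smul k x _ ih =>
    intro c hc
    rw [smul_smul] at hc ⊢
    exact ih _ hc
  | add x y _ _ hx hy =>
    intro c hc
    -- Shrink x and y into the ball, take the midpoint, then rescale.
    obtain ⟨r, hr0, hr⟩ : ∃ r : ℝ, 0 < r ∧ r * (‖x‖ + ‖y‖) < 1 :=
      ⟨1 / (‖x‖ + ‖y‖ + 1), by positivity, by
        rw [div_mul_eq_mul_div, div_lt_one (by positivity)]
        linarith⟩
    have hr1 : ‖(r : ℂ)‖ = r := by rw [Complex.norm_real, Real.norm_eq_abs, abs_of_pos hr0]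
    have hrC : (r : ℂ) ≠ 0 := by exact_mod_cast hr0.ne'
    have hnx : ‖(r : ℂ) • x‖ = r * ‖x‖ := by rw [norm_smul, hr1]
    have hny : ‖(r : ℂ) • y‖ = r * ‖y‖ := by rw [norm_smul, hr1]
    have hxr := mul_nonneg hr0.le (norm_nonneg x)
    have hyr := mul_nonneg hr0.le (norm_nonneg y)
    have e : (1 - (1 / 2 : ℂ)) • (r : ℂ) • x + (1 / 2 : ℂ) • (r : ℂ) • y
        = ((r : ℂ) / 2) • (x + y) := by
      module
    have hmid := hline _ (hx r (by rw [hnx]; linarith)) _ (hy r (by rw [hny]; linarith)) (1 / 2)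
      (by
        rw [e, norm_smul, norm_div, hr1, Complex.norm_ofNat]
        nlinarith [norm_add_le x y])
    rw [e] at hmid
    have e2 : (c * (2 / r)) • ((r : ℂ) / 2) • (x + y) = c • (x + y) := by
      rw [smul_smul]
      congr 1
      field_simp
    rw [← e2]
    exact hsmul _ hmid _ (by rw [e2]; exact hc)

/-- Every subspace of `ℂ^d` is a unitary image of a coordinate subspace. -/
theorem exists_unitary_image_subBall (S : Submodule ℂ (Cn d)) :
    ∃ k ≤ d, ∃ U : Cn d ≃ₗᵢ[ℂ] Cn d, {z | z ∈ unitBall d ∧ z ∈ S} = U '' subBall d k := by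
  set k := Module.finrank ℂ S with hk
  have hkd : k ≤ d := by
    simpa using Submodule.finrank_le S
  let B := stdOrthonormalBasis ℂ S
  let v : Fin d → Cn d := fun i => if h : (i : ℕ) < k then (B ⟨i, h⟩ : Cn d) else 0
  have hv : Orthonormal ℂ (({i : Fin d | (i : ℕ) < k}).domRestrict v) := by
    have h1 : Orthonormal ℂ fun i : Fin k => (B i : Cn d) :=
      B.orthonormal.comp_linearIsometry S.subtypeₗᵢ
    have h2 := h1.comp (fun i : {i : Fin d | (i : ℕ) < k} => (⟨i.1, i.2⟩ : Fin k))
      fun i j hij => by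
        simp only [Fin.mk.injEq] at hij
        exact Subtype.ext (Fin.ext hij)
    convert! h2 using 1
    ext1 i
    have hi : (i.1 : ℕ) < k := i.2
    simp [v, Set.domRestrict, hi]
  obtain ⟨b, hb⟩ := hv.exists_orthonormalBasis_extension_of_card_eq (by simp)
  have hbv : ∀ (i : Fin d) (h : (i : ℕ) < k), b i = B ⟨i, h⟩ := fun i h => by
    rw [hb i h]
    simp [v, h]
  have hbS : ∀ (i : Fin d), (i : ℕ) < k → b i ∈ S := fun i h => hbv i h ▸ (B ⟨i, h⟩).2
  refine ⟨k, hkd, b.repr.symm, Set.Subset.antisymm ?_ ?_⟩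
  · rintro z ⟨hz, hzS⟩
    refine ⟨b.repr z, ⟨?_, fun i hi => ?_⟩, b.repr.symm_apply_apply z⟩
    · rw [unitBall, mem_ball_zero_iff] at hz ⊢
      rwa [LinearIsometryEquiv.norm_map]
    · rw [b.repr_apply_apply]
      have e : z = ∑ j, B.repr ⟨z, hzS⟩ j • (B j : Cn d) := by
        have := congrArg (Subtype.val) (B.sum_repr ⟨z, hzS⟩)
        exact this.symm.trans (by simp)
      rw [e, inner_sum]
      refine Finset.sum_eq_zero fun j _ => ?_
      rw [inner_smul_right]
      have hj : (B j : Cn d) = b ⟨j, j.2.trans_le hkd⟩ := (hbv ⟨j, j.2.trans_le hkd⟩ j.2).symm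
      rw [hj, b.inner_eq_zero, mul_zero]
      intro h
      have := congrArg Fin.val h
      simp only at this
      have := j.2
      omega
  · rintro _ ⟨w, ⟨hw, hw0⟩, rfl⟩
    refine ⟨?_, ?_⟩
    · rw [unitBall, mem_ball_zero_iff] at hw ⊢
      rwa [LinearIsometryEquiv.norm_map]
    · rw [← b.sum_repr_symm]
      refine Submodule.sum_mem _ fun i _ => ?_
      rcases lt_or_ge (i : ℕ) k with h | h
      · exact S.smul_mem _ (hbS i h)
      · rw [hw0 i h, zero_smul]
        exact S.zero_mem

/-- The retraction is the coordinate projection conjugated by Φ. -/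
theorem IsAutomorphism.isRetract_image_subBall {Φ : Cn d → Cn d}
    (hΦ : IsAutomorphism (unitBall d) Φ) (k : ℕ) :
    IsRetract (unitBall d) (Φ '' subBall d k) := by
  obtain ⟨hd, hm, Ψ, hd', hm', hl, hr⟩ := hΦ
  let P : Cn d → Cn d := fun z => WithLp.toLp 2 fun i => if (i : ℕ) < k then z i else 0
  have hP : Differentiable ℂ P := by
    rw [differentiable_euclidean]
    intro i
    by_cases h : (i : ℕ) < k <;> simp only [P, h, if_true, if_false] <;> fun_prop
  have hPsub : ∀ z ∈ unitBall d, P z ∈ subBall d k := fun z hz => by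
    refine ⟨?_, fun i hi => by simp [P, not_lt.mpr hi]⟩
    rw [unitBall, mem_ball_zero_iff] at hz ⊢
    refine lt_of_le_of_lt ?_ hz
    rw [EuclideanSpace.norm_eq, EuclideanSpace.norm_eq]
    refine Real.sqrt_le_sqrt (Finset.sum_le_sum fun i _ => ?_)
    by_cases h : (i : ℕ) < k <;> simp [P, h]
  have hPid : ∀ z ∈ subBall d k, P z = z := fun z hz => by
    ext i
    by_cases h : (i : ℕ) < k
    · simp [P, h]
    · simp [P, h, hz.2 i (not_lt.mp h)]
  have hPm : Set.MapsTo P (unitBall d) (unitBall d) := fun z hz => (hPsub z hz).1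
  refine ⟨fun z => Φ (P (Ψ z)), hd.comp (hP.comp_differentiableOn hd') (hPm.comp hm'),
    hm.comp (hPm.comp hm'), Set.Subset.antisymm ?_ ?_, ?_⟩
  · rintro _ ⟨z, hz, rfl⟩
    exact ⟨_, hPsub _ (hm' hz), rfl⟩
  · rintro _ ⟨z, hz, rfl⟩
    exact ⟨Φ z, hm hz.1, by simp only [hl hz.1, hPid z hz]⟩
  · rintro _ ⟨z, hz, rfl⟩
    simp only [hl hz.1, hPid z hz]

theorem isAutomorphism_moebius_comp (ha : ‖a‖ < 1) (U : Cn d ≃ₗᵢ[ℂ] Cn d) :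
    IsAutomorphism (unitBall d) fun z => moebius a (U z) := by
  have hU : ∀ (U : Cn d ≃ₗᵢ[ℂ] Cn d), Set.MapsTo U (unitBall d) (unitBall d) := fun U z hz => by
    rw [unitBall, mem_ball_zero_iff] at hz ⊢
    rwa [U.norm_map]
  have hm : Set.MapsTo (moebius a) (unitBall d) (unitBall d) := fun z hz =>
    mem_ball_zero_iff.mpr (norm_moebius_lt_one ha (mem_ball_zero_iff.mp hz))
  have hd : DifferentiableOn ℂ (moebius a) (unitBall d) := fun z hz =>
    (differentiableAt_moebius ha (mem_ball_zero_iff.mp hz).le).differentiableWithinAt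
  have hinv : ∀ z ∈ unitBall d, moebius a (moebius a z) = z := fun z hz =>
    moebius_moebius ha (mem_ball_zero_iff.mp hz).le
  refine ⟨hd.comp U.differentiable.differentiableOn (hU U), hm.comp (hU U),
    fun z => U.symm (moebius a z), U.symm.differentiable.comp_differentiableOn hd,
    (hU U.symm).comp hm, fun z hz => ?_, fun z hz => ?_⟩
  · simp only [hinv _ (hU U hz), U.symm_apply_apply]
  · simp only [U.apply_symm_apply, hinv z hz]

end Geometry

end BallExtension

open BallExtension in
theorem theorem3p1 (d : ℕ) (V : Set (BallExtension.Cn d)) (hne : V.Nonempty)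
    (hconv : BallExtension.RelPolyConvex (BallExtension.unitBall d) V)
    (hext : BallExtension.HasExtensionProperty (BallExtension.unitBall d) V) :
    BallExtension.IsRetract (BallExtension.unitBall d) V ∧
      ∃ k : ℕ, k ≤ d ∧ ∃ Φ : BallExtension.Cn d → BallExtension.Cn d,
        BallExtension.IsAutomorphism (BallExtension.unitBall d) Φ ∧
          V = Φ '' BallExtension.subBall d k := by
  obtain ⟨a, ha⟩ := hne
  have hball : ∀ v ∈ V, ‖v‖ < 1 := fun v hv => by
    rw [← hconv] at hv
    exact mem_ball_zero_iff.mp hv.2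
  have ha1 := hball a ha
  have hW := eq_span_inter_unitBall (W := moebius a '' V)
    (by
      rintro _ ⟨v, hv, rfl⟩
      exact mem_ball_zero_iff.mpr (norm_moebius_lt_one ha1 (hball v hv)))
    ⟨a, ha, moebius_self ha1⟩
    (fun p hp q hq c hc => affine_combination_mem_image_moebius hconv hext ha hp hq hc)
  obtain ⟨k, hk, U, hU⟩ := exists_unitary_image_subBall (Submodule.span ℂ (moebius a '' V))
  have hVeq : V = (fun z => moebius a (U z)) '' subBall d k := by
    rw [← Set.image_image (moebius a) U, ← hU, ← hW, Set.image_image]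
    exact (Set.EqOn.image_eq_self fun v hv => moebius_moebius ha1 (hball v hv).le).symm
  have hΦ := isAutomorphism_moebius_comp ha1 U
  refine ⟨?_, k, hk, _, hΦ, hVeq⟩
  rw [hVeq]
  exact hΦ.isRetract_image_subBall k
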